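/- For integers $n,k\ge 0$, a word $w=w_1w_2\cdots w_n$ avoids a permutation $\sigma=\sigma_1\cdots\sigma_k$ of $\{1,\dots,k\}$ if there are no indices $i_1<i_2<\cdots<i_k$ such that $w_{i_1}w_{i_2}\cdots w_{i_k}$ is order isomorphic to $\sigma$. A permutation $\pi=\pi_1\cdots\pi_n$ of $\{1,\dots,n\}$ is a ballot permutation if no prefix of $\pi$ has more descents ($\pi_i>\pi_{i+1}$) than ascents ($\pi_i<\pi_{i+1}$); let $\mathcal B_n(231)$ be the set of ballot permutations of $\{1,\dots,n\}$ that avoid $231$. For integers $n,h,b\ge 0$, a permutation $\pi$ of $\{1,\dots,n+1\}$ is an $(h,b)$-ballot permutation if the lattice path that starts at $(0,h)$ and whose $i$-th step, for $1\le i\le n$, is $(1,1)$ if $\pi_i<\pi_{i+1}$ and $(1,-1)$ if $\pi_i>\pi_{i+1}$, never passes below the $x$-axis and ends at $(n,b)$. An $n$-step Gouyou-Beauchamps walk is a lattice walk with $n$ steps, each one of $(0,1),(0,-1),(-1,0),(1,0)$, all of whose vertices $(x,y)$ satisfy $0\le y\le x$. Theorem. For all integers $n,h,b\ge 0$, the number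 of $231$-avoiding $(h,b)$-ballot permutations of $\{1,\dots,n+1\}$ equals the number of $n$-step Gouyou-Beauchamps walks that start at $(h,0)$ and end at $(b,0)$. In particular, for every integer $n\ge 0$, $$|\mathcal B_n(231)|=C(\lfloor n/2\rfloor)\,C(\lfloor (n+1)/2\rfloor),$$ where $C(m)=\frac{1}{m+1}\binom{2m}{m}$ is the $m$-th Catalan number. -/

import Mathlib

/-- The word `w` avoids the pattern `σ = σ₁σ₂⋯σₖ`: no subword `w_{i₁}w_{i₂}⋯w_{iₖ}` with
`i₁ < i₂ < ⋯ < iₖ` is order isomorphic to `σ`. -/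
def AvoidsPattern {α : Type*} [LinearOrder α] {n k : ℕ} (w : Fin n → α)
    (σ : Equiv.Perm (Fin k)) : Prop :=
  ¬ ∃ i : Fin k → Fin n, StrictMono i ∧ ∀ r s : Fin k, w (i r) < w (i s) ↔ σ r < σ s

/-- The permutation with one-line notation `2 3 1` (letters are shifted to `0, 1, 2`). -/
def pattern231 : Equiv.Perm (Fin 3) where
  toFun := ![1, 2, 0]
  invFun := ![2, 0, 1]
  left_inv := by decide
  right_inv := by decide

/-- Number of ascents in the prefix of length `k` of `π`. -/
def prefixAsc {n : ℕ} (π : Equiv.Perm (Fin n)) (k : ℕ) : ℕ :=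
  (Finset.univ.filter fun i : Fin n =>
    ∃ hi : i.val + 1 < n, i.val + 1 < k ∧ π i < π ⟨i.val + 1, hi⟩).card

/-- Number of descents in the prefix of length `k` of `π`. -/
def prefixDes {n : ℕ} (π : Equiv.Perm (Fin n)) (k : ℕ) : ℕ :=
  (Finset.univ.filter fun i : Fin n =>
    ∃ hi : i.val + 1 < n, i.val + 1 < k ∧ π ⟨i.val + 1, hi⟩ < π i).card

/-- Ballot permutations: no prefix has more descents than ascents. -/
def IsBallotPerm {n : ℕ} (π : Equiv.Perm (Fin n)) : Prop :=
  ∀ k : ℕ, k ≤ n → prefixDes π k ≤ prefixAsc π k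

/-- The ordinate, after `k` steps, of the lattice path that starts at `(0, h)` and whose successive
steps are `(1, 1)` at an ascent and `(1, -1)` at a descent of `π`. -/
def ascDesHeight {n : ℕ} (h : ℕ) (π : Equiv.Perm (Fin (n + 1))) (k : Fin (n + 1)) : ℤ :=
  h + ∑ i : Fin n,
    if i.val < k.val then (if π i.castSucc < π i.succ then 1 else -1) else 0

/-- `(h, b)`-ballot permutations of length `n + 1`: the associated path from `(0, h)` never goes
below the `x`-axis and ends at `(n, b)`. -/
def IsHBBallotPerm {n : ℕ} (h b : ℕ) (π : Equiv.Perm (Fin (n + 1))) : Prop :=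
  (∀ k : Fin (n + 1), 0 ≤ ascDesHeight h π k) ∧ ascDesHeight h π (Fin.last n) = b

/-- The set `{↑, ↓, ←, →}` of steps. -/
def gbSteps : Set (ℤ × ℤ) := {(0, 1), (0, -1), (-1, 0), (1, 0)}

/-- An `n`-step Gouyou-Beauchamps walk, as its sequence of vertices: it stays in the quarter plane,
weakly below the diagonal `y = x`, and uses only the steps `↑, ↓, ←, →`. -/
def IsGBWalk {n : ℕ} (w : Fin (n + 1) → ℤ × ℤ) : Prop :=
  (∀ k : Fin (n + 1), 0 ≤ (w k).1 ∧ 0 ≤ (w k).2 ∧ (w k).2 ≤ (w k).1) ∧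
    ∀ k : Fin n, w k.succ - w k.castSucc ∈ gbSteps

/-- The `n`-step Gouyou-Beauchamps walks that start at `(h, 0)` and end at `(b, 0)`. -/
def gbWalks (n h b : ℕ) : Set (Fin (n + 1) → ℤ × ℤ) :=
  {w | IsGBWalk w ∧ w 0 = ((h : ℤ), 0) ∧ w (Fin.last n) = ((b : ℤ), 0)}

/-- The set of `231`-avoiding `(h, b)`-ballot permutations of length `n + 1`. -/
def hbBallotPerms231 (n h b : ℕ) : Set (Equiv.Perm (Fin (n + 1))) :=
  {π | IsHBBallotPerm h b π ∧ AvoidsPattern π pattern231}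

/-- The set of `231`-avoiding ballot permutations of length `n`. -/
def ballotPerms231 (n : ℕ) : Set (Equiv.Perm (Fin n)) :=
  {π | IsBallotPerm π ∧ AvoidsPattern π pattern231}

/-!
Build permutations by prepending a letter. A letter `a` can be put in front of a `231`-avoiding `π`
exactly when the letters below `a` form a prefix of `π`, so a nonzero `a` is the end of one of the
direct-sum blocks of `π`. If `π` has `c` blocks, then the new permutation has `c + 1` blocks when it
starts with an ascent (`a = 0`), and each of `1, …, c` blocks exactly once when it starts with a
descent. Weight `π` by the number `(c - 1).choose y` of ways to mark `y` of the gaps between its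
blocks: Pascal's rule and the hockey-stick identity turn this succession rule into the recursion for
the Gouyou-Beauchamps walks that start at `(h + y, y)`.

Along such a walk `x - y` and `x + y + 2` are two simple paths that never meet, so the walks are
counted by a `2 × 2` determinant of reflection-principle numbers (Lindström, Gessel, Viennot). For
walks from the origin to the axis these determinants telescope when summed over the endpoint.
-/

open Finset

section LatticeWalks

variable {G : Type*} [AddGroup G]

/-- The `n`-step lattice walks from `p` to `q` with steps in `S` and all vertices in the region `R`,
as sequences of vertices. -/
def latticeWalks (R : Set G) (S : Finset G) (n : ℕ) (p q : G) : Set (Fin (n + 1) → G) :=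
  {w | (∀ k, w k ∈ R) ∧ (∀ k : Fin n, w k.succ - w k.castSucc ∈ S) ∧ w 0 = p ∧ w (Fin.last n) = q}

/-- The number of `n`-step lattice walks from `p` to `q` with steps in `S` inside the region `R`. -/
noncomputable def numLatticeWalks (R : Set G) (S : Finset G) (n : ℕ) (p q : G) : ℕ :=
  (latticeWalks R S n p q).ncard

variable {R : Set G} {S : Finset G} {p : G}

theorem latticeWalks_of_notMem (hp : p ∉ R) (n : ℕ) (q : G) : latticeWalks R S n p q = ∅ :=
  Set.eq_empty_of_forall_notMem fun _ ⟨hR, _, h0, _⟩ => hp (h0 ▸ hR 0)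

theorem latticeWalks_zero_subset (p q : G) : latticeWalks R S 0 p q ⊆ {fun _ => p} := by
  rintro w ⟨-, -, h0, -⟩
  funext k
  rw [Fin.fin_one_eq_zero k, h0]

theorem cons_mem_latticeWalks (hp : p ∈ R) {n : ℕ} {q : G} {w : Fin (n + 1) → G} :
    (Fin.cons p w : Fin (n + 2) → G) ∈ latticeWalks R S (n + 1) p q ↔
      ∃ s ∈ S, w ∈ latticeWalks R S n (s + p) q := by
  simp only [latticeWalks, Set.mem_ofPred_eq, Fin.forall_fin_succ (n := n + 1),
    Fin.forall_fin_succ (n := n), Fin.cons_zero, Fin.cons_succ, Fin.castSucc_zero,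
    ← Fin.succ_castSucc, ← Fin.succ_last, ← sub_eq_iff_eq_add]
  grind

theorem latticeWalks_succ (hp : p ∈ R) (n : ℕ) (q : G) :
    latticeWalks R S (n + 1) p q =
      ⋃ s ∈ (S : Set G), Fin.cons (α := fun _ => G) p '' latticeWalks R S n (s + p) q := by
  ext w
  refine Fin.consCases (fun p' w => ?_) w
  simp only [Set.mem_iUnion, Set.mem_image, Fin.cons_inj, mem_coe, exists_prop]
  constructor
  · intro hw
    obtain rfl : p' = p := hw.2.2.1
    obtain ⟨s, hs, hw⟩ := (cons_mem_latticeWalks hp).1 hw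
    exact ⟨s, hs, w, hw, rfl, rfl⟩
  · rintro ⟨s, hs, w, hw, rfl, rfl⟩
    exact (cons_mem_latticeWalks hp).2 ⟨s, hs, hw⟩

theorem finite_latticeWalks (R : Set G) (S : Finset G) (n : ℕ) (p q : G) :
    (latticeWalks R S n p q).Finite := by
  by_cases hp : p ∈ R
  · induction n generalizing p with
    | zero => exact (Set.finite_singleton _).subset (latticeWalks_zero_subset p q)
    | succ n ih =>
      rw [latticeWalks_succ hp]
      refine S.finite_toSet.biUnion fun s _ => Set.Finite.image _ ?_
      by_cases hs : s + p ∈ R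
      · exact ih (s + p) hs
      · simp [latticeWalks_of_notMem hs]
  · simp [latticeWalks_of_notMem hp]

theorem numLatticeWalks_of_notMem (hp : p ∉ R) (n : ℕ) (q : G) : numLatticeWalks R S n p q = 0 := by
  simp [numLatticeWalks, latticeWalks_of_notMem hp]

theorem numLatticeWalks_zero [DecidableEq G] (hp : p ∈ R) (q : G) :
    numLatticeWalks R S 0 p q = if p = q then 1 else 0 := by
  split_ifs with hpq
  · have : latticeWalks R S 0 p q = {fun _ => p} :=
      (latticeWalks_zero_subset p q).antisymm <| by
        rintro _ rfl
        exact ⟨fun _ => hp, fun k => k.elim0, rfl, hpq⟩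
    rw [numLatticeWalks, this, Set.ncard_singleton]
  · have : latticeWalks R S 0 p q = ∅ :=
      Set.eq_empty_of_forall_notMem fun _ ⟨_, _, h0, hq⟩ => hpq (h0.symm.trans hq)
    rw [numLatticeWalks, this, Set.ncard_empty]

theorem numLatticeWalks_succ (hp : p ∈ R) (n : ℕ) (q : G) :
    numLatticeWalks R S (n + 1) p q = ∑ s ∈ S, numLatticeWalks R S n (s + p) q := by
  have hdisj : (S : Set G).PairwiseDisjoint fun s =>
      Fin.cons (α := fun _ => G) p '' latticeWalks R S n (s + p) q := by
    intro s _ t _ hst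
    rw [Function.onFun, Set.disjoint_image_iff (Fin.cons_right_injective (α := fun _ => G) p),
      Set.disjoint_left]
    rintro w ⟨-, -, hs, -⟩ ⟨-, -, ht, -⟩
    exact hst (add_right_cancel (hs.symm.trans ht))
  rw [numLatticeWalks, latticeWalks_succ hp, S.finite_toSet.ncard_biUnion
    (fun _ _ => (finite_latticeWalks R S n _ q).image _) hdisj, finsum_mem_coe_finset]
  simp only [Set.ncard_image_of_injective _ (Fin.cons_right_injective (α := fun _ => G) p),
    numLatticeWalks]

theorem cast_numLatticeWalks_eq_of_recurrence {M : Type*} [AddCommMonoidWithOne M] [DecidableEq G]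
    {q : G} {f : ℕ → G → M} (hzero : ∀ p ∈ R, f 0 p = if p = q then 1 else 0)
    (hsucc : ∀ n, ∀ p ∈ R, f (n + 1) p = ∑ s ∈ S, f n (s + p))
    (hexit : ∀ n, ∀ p ∈ R, ∀ s ∈ S, s + p ∉ R → f n (s + p) = 0) (n : ℕ) (hp : p ∈ R) :
    (numLatticeWalks R S n p q : M) = f n p := by
  induction n generalizing p with
  | zero => rw [numLatticeWalks_zero hp, hzero p hp, Nat.cast_ite, Nat.cast_one, Nat.cast_zero]
  | succ n ih =>
    rw [numLatticeWalks_succ hp, hsucc n p hp, Nat.cast_sum]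
    refine sum_congr rfl fun s hs => ?_
    by_cases hsp : s + p ∈ R
    · exact ih hsp
    · rw [numLatticeWalks_of_notMem hsp, hexit n p hp s hs hsp, Nat.cast_zero]

end LatticeWalks

section GouyouBeauchamps

/-- The wedge `0 ≤ y ≤ x` that contains the Gouyou-Beauchamps walks. -/
def gbWedge : Set (ℤ × ℤ) := {p | 0 ≤ p.1 ∧ 0 ≤ p.2 ∧ p.2 ≤ p.1}

theorem mem_gbWedge {x y : ℤ} : (x, y) ∈ gbWedge ↔ 0 ≤ x ∧ 0 ≤ y ∧ y ≤ x := Iff.rfl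

/-- `gbSteps` as a finset, to sum over. -/
def gbStepFinset : Finset (ℤ × ℤ) := {(0, 1), (0, -1), (-1, 0), (1, 0)}

theorem sum_gbStepFinset {M : Type*} [AddCommMonoid M] (f : ℤ × ℤ → M) :
    ∑ s ∈ gbStepFinset, f s = f (0, 1) + (f (0, -1) + (f (-1, 0) + f (1, 0))) := by
  rw [gbStepFinset, sum_insert (by decide), sum_insert (by decide), sum_insert (by decide),
    sum_singleton]

/-- The number of `n`-step Gouyou-Beauchamps walks from `p` to `q`. -/
noncomputable def numGBWalks (n : ℕ) (p q : ℤ × ℤ) : ℕ := numLatticeWalks gbWedge gbStepFinset n p q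

theorem gbWalks_eq_latticeWalks (n h b : ℕ) :
    gbWalks n h b = latticeWalks gbWedge gbStepFinset n ((h : ℤ), 0) ((b : ℤ), 0) := by
  ext w
  simp only [gbWalks, IsGBWalk, latticeWalks, gbWedge, gbSteps, gbStepFinset, Set.mem_ofPred_eq,
    Set.mem_insert_iff, Set.mem_singleton_iff, mem_insert, mem_singleton, and_assoc]

theorem encard_gbWalks (n h b : ℕ) :
    (gbWalks n h b).encard = numGBWalks n ((h : ℤ), 0) ((b : ℤ), 0) := by
  rw [gbWalks_eq_latticeWalks, numGBWalks, numLatticeWalks,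
    (finite_latticeWalks gbWedge gbStepFinset n _ _).cast_ncard_eq]

theorem numGBWalks_zero (h y : ℕ) (q : ℤ × ℤ) :
    numGBWalks 0 ((h + y : ℕ), y) q = if (((h + y : ℕ) : ℤ), (y : ℤ)) = q then 1 else 0 :=
  numLatticeWalks_zero (mem_gbWedge.2 (by omega)) q

theorem numGBWalks_of_notMem {p : ℤ × ℤ} (hp : p ∉ gbWedge) (n : ℕ) (q : ℤ × ℤ) :
    numGBWalks n p q = 0 :=
  numLatticeWalks_of_notMem hp n q

theorem numGBWalks_succ {x y : ℤ} (hp : (x, y) ∈ gbWedge) (n : ℕ) (q : ℤ × ℤ) :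
    numGBWalks (n + 1) (x, y) q =
      numGBWalks n (x, y + 1) q + numGBWalks n (x, y - 1) q +
        numGBWalks n (x - 1, y) q + numGBWalks n (x + 1, y) q := by
  rw [numGBWalks, numLatticeWalks_succ hp, sum_gbStepFinset]
  simp only [Prod.mk_add_mk, zero_add, numGBWalks, neg_add_eq_sub, add_comm (1 : ℤ), add_assoc]

theorem numGBWalks_succ_nat (n h y : ℕ) (q : ℤ × ℤ) :
    numGBWalks (n + 1) ((h + y : ℕ), y) q =
      (numGBWalks n ((h + 1 + y : ℕ), y) q +
        if y = 0 then 0 else numGBWalks n ((h + 1 + (y - 1) : ℕ), (y - 1 : ℕ)) q) +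
      if h = 0 then 0 else
        numGBWalks n ((h - 1 + y : ℕ), y) q +
          numGBWalks n ((h - 1 + (y + 1) : ℕ), (y + 1 : ℕ)) q := by
  have exit {x z : ℤ} (hxz : z < 0 ∨ x < z) : numGBWalks n (x, z) q = 0 :=
    numGBWalks_of_notMem (by rw [mem_gbWedge]; omega) n q
  have move {x z x' z' : ℤ} (hx : x = x') (hz : z = z') :
      numGBWalks n (x, z) q = numGBWalks n (x', z') q := by rw [hx, hz]
  have right : numGBWalks n ((h + y : ℕ) + 1, y) q = numGBWalks n ((h + 1 + y : ℕ), y) q :=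
    move (by omega) rfl
  have down : numGBWalks n ((h + y : ℕ), y - 1) q =
      if y = 0 then 0 else numGBWalks n ((h + 1 + (y - 1) : ℕ), (y - 1 : ℕ)) q := by
    split_ifs
    · exact exit (by omega)
    · exact move (by omega) (by omega)
  have left_add_up : numGBWalks n ((h + y : ℕ) - 1, y) q + numGBWalks n ((h + y : ℕ), y + 1) q =
      if h = 0 then 0 else
        numGBWalks n ((h - 1 + y : ℕ), y) q +
          numGBWalks n ((h - 1 + (y + 1) : ℕ), (y + 1 : ℕ)) q := by
    split_ifs
    · rw [exit (by omega), exit (by omega)]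
    · exact congrArg₂ _ (move (by omega) rfl) (move (by omega) (by omega))
  rw [numGBWalks_succ (mem_gbWedge.2 (by omega)), ← right, ← down, ← left_add_up]
  ring

end GouyouBeauchamps

section PrependLetter

/-- The permutation whose one-line notation is `a` followed by that of `π`, the letters of `π` that
are at least `a` being increased by one. -/
def consPerm {n : ℕ} (a : Fin (n + 1)) (π : Equiv.Perm (Fin n)) : Equiv.Perm (Fin (n + 1)) :=
  (finSuccEquiv' 0).trans (π.optionCongr.trans (finSuccEquiv' a).symm)

variable {n : ℕ}

@[simp]
theorem consPerm_zero (a : Fin (n + 1)) (π : Equiv.Perm (Fin n)) : consPerm a π 0 = a := by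
  simp [consPerm]

@[simp]
theorem consPerm_succ (a : Fin (n + 1)) (π : Equiv.Perm (Fin n)) (i : Fin n) :
    consPerm a π i.succ = a.succAbove (π i) := by
  have : finSuccEquiv' (0 : Fin (n + 1)) i.succ = some i := by
    rw [← Fin.succAbove_zero, finSuccEquiv'_succAbove]
  simp [consPerm, this]

theorem consPerm_bijective (n : ℕ) :
    Function.Bijective fun p : Fin (n + 1) × Equiv.Perm (Fin n) => consPerm p.1 p.2 := by
  rw [Fintype.bijective_iff_injective_and_card]
  constructor
  · rintro ⟨a, π⟩ ⟨a', π'⟩ h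
    obtain rfl : a = a' := by simpa using Equiv.congr_fun h 0
    refine Prod.ext rfl (Equiv.ext fun i => ?_)
    simpa using Equiv.congr_fun h i.succ
  · simp [Fintype.card_perm, Nat.factorial_succ]

theorem sum_perm_fin_succ {M : Type*} [AddCommMonoid M] (f : Equiv.Perm (Fin (n + 1)) → M) :
    ∑ σ, f σ = ∑ π : Equiv.Perm (Fin n), ∑ a, f (consPerm a π) := by
  rw [sum_comm, ← Fintype.sum_prod_type']
  exact ((consPerm_bijective n).sum_comp f).symm

theorem succAbove_lt_succ_iff {a : Fin (n + 1)} {m : ℕ} (ha : a.val ≤ m) (i : Fin n) :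
    (a.succAbove i).val < m + 1 ↔ i.val < m := by
  rcases Fin.castSucc_lt_or_lt_succ a i with h | h
  · rw [Fin.succAbove_of_castSucc_lt _ _ h]
    simp only [Fin.lt_def, Fin.val_castSucc] at h ⊢
    omega
  · rw [Fin.succAbove_of_lt_succ _ _ h, Fin.val_succ, Nat.succ_lt_succ_iff]

end PrependLetter

section Cuts

variable {n : ℕ}

/-- The first `m` letters of `π` are the `m` smallest ones. -/
def IsCut (π : Equiv.Perm (Fin n)) (m : ℕ) : Prop :=
  ∀ i : Fin n, i.val < m → (π i).val < m

theorem isCut_zero (π : Equiv.Perm (Fin n)) : IsCut π 0 := fun _ hi => absurd hi (Nat.not_lt_zero _)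

theorem IsCut.lt_iff {m : ℕ} {π : Equiv.Perm (Fin n)} (h : IsCut π m) (i : Fin n) :
    (π i).val < m ↔ i.val < m := by
  refine ⟨fun hi => ?_, h i⟩
  set s : Finset (Fin n) := {j | j.val < m} with hs
  have maps : s.map π.toEmbedding ⊆ s := fun j hj => by
    obtain ⟨k, hk, rfl⟩ := mem_map.1 hj
    simpa [hs] using h k (by simpa [hs] using hk)
  have surj : s.map π.toEmbedding = s := eq_of_subset_of_card_le maps (by simp)
  have : π.toEmbedding i ∈ s.map π.toEmbedding := by rw [surj]; simpa [hs] using hi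
  simpa [hs] using (mem_map' _).1 this

theorem isCut_iff_forall_lt {π : Equiv.Perm (Fin n)} {m : ℕ} :
    IsCut π m ↔ ∀ i j : Fin n, i < j → (π j).val < m → (π i).val < m := by
  refine ⟨fun h i j hij hj => ?_, fun h => ?_⟩
  · have := (h.lt_iff j).1 hj
    exact h i (by omega)
  · by_contra hcut
    simp only [IsCut, not_forall, not_lt] at hcut
    obtain ⟨i, him, hi⟩ := hcut
    have hsymm : IsCut π.symm m := fun v hv => by
      by_contra hvm
      have := h i (π.symm v) (by omega) (by simpa using hv)
      omega
    have := (hsymm.lt_iff (π i)).1 (by simpa using him)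
    omega

theorem isCut_consPerm (a : Fin (n + 1)) (π : Equiv.Perm (Fin n)) (m : ℕ) :
    IsCut (consPerm a π) (m + 1) ↔ a.val ≤ m ∧ IsCut π m := by
  have head : (∀ i : Fin (n + 1), i.val < m + 1 → (consPerm a π i).val < m + 1) ↔
      a.val ≤ m ∧ ∀ i : Fin n, i.val < m → (a.succAbove (π i)).val < m + 1 := by
    simp [Fin.forall_fin_succ]
  rw [IsCut, head]
  exact and_congr_right fun ha => by simp only [succAbove_lt_succ_iff ha, IsCut]

theorem avoidsPattern231_iff {α : Type*} [LinearOrder α] (w : Fin n → α) :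
    AvoidsPattern w pattern231 ↔ ∀ i j k : Fin n, i < j → j < k → w k < w i → w j ≤ w i := by
  constructor
  · intro h i j k hij hjk hki
    by_contra! hlt
    refine h ⟨![i, j, k], ?_, ?_⟩
    · rw [Fin.strictMono_iff_lt_succ]
      intro r
      fin_cases r <;> simpa
    · intro r s
      fin_cases r <;> fin_cases s <;>
        simp [pattern231, hki, hlt, hki.trans hlt, hki.le, hlt.le, (hki.trans hlt).le]
  · rintro h ⟨f, hf, hfs⟩
    have hki : w (f 2) < w (f 0) := (hfs 2 0).2 (by decide)
    have hlt : w (f 0) < w (f 1) := (hfs 0 1).2 (by decide)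
    exact (h (f 0) (f 1) (f 2) (hf (by decide)) (hf (by decide)) hki).not_gt hlt

theorem avoidsPattern231_consPerm (a : Fin (n + 1)) (π : Equiv.Perm (Fin n)) :
    AvoidsPattern (consPerm a π) pattern231 ↔ AvoidsPattern π pattern231 ∧ IsCut π a := by
  have lt_iff (i : Fin n) : a.succAbove (π i) < a ↔ (π i).val < a.val :=
    Fin.succAbove_lt_iff_castSucc_lt a (π i)
  have le_iff (i : Fin n) : a.succAbove (π i) ≤ a ↔ (π i).val < a.val := by
    rw [(a.succAbove_ne (π i)).le_iff_lt, lt_iff]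
  simp only [avoidsPattern231_iff, isCut_iff_forall_lt, Fin.forall_fin_succ (n := n),
    consPerm_zero, consPerm_succ, Fin.succ_lt_succ_iff, Fin.succAbove_lt_succAbove_iff,
    Fin.succAbove_le_succAbove_iff, lt_iff, le_iff]
  simp [and_comm]

end Cuts

section BlockEnds

variable {n : ℕ}

open Classical in
/-- The (zero-based) positions at which the direct-sum blocks of `π` end; their number is the number
of blocks. -/
noncomputable def blockEnds (π : Equiv.Perm (Fin n)) : Finset (Fin n) := {i | IsCut π (i + 1)}

theorem mem_blockEnds {π : Equiv.Perm (Fin n)} {i : Fin n} :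
    i ∈ blockEnds π ↔ IsCut π (i + 1) := by
  simp [blockEnds]

theorem last_mem_blockEnds (π : Equiv.Perm (Fin (n + 1))) : Fin.last n ∈ blockEnds π :=
  mem_blockEnds.2 fun _ _ => (π _).isLt

theorem blockEnds_consPerm_zero (π : Equiv.Perm (Fin n)) :
    blockEnds (consPerm 0 π) = cons 0 ((blockEnds π).map (Fin.succEmb n)) (by simp) := by
  ext i
  cases i using Fin.cases <;> simp [mem_blockEnds, isCut_consPerm, isCut_zero]

theorem blockEnds_consPerm_succ (a : Fin n) (π : Equiv.Perm (Fin n)) :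
    blockEnds (consPerm a.succ π) = {i ∈ blockEnds π | a ≤ i}.map (Fin.succEmb n) := by
  ext i
  cases i using Fin.cases <;> simp [mem_blockEnds, isCut_consPerm, and_comm]

theorem sum_card_filter_le {α M : Type*} [LinearOrder α] [AddCommMonoid M] (s : Finset α)
    (f : ℕ → M) : ∑ a ∈ s, f #{i ∈ s | a ≤ i} = ∑ k ∈ range #s, f (k + 1) := by
  induction s using Finset.induction_on_min with
  | empty => simp
  | insert a s ha ih =>
    have has : a ∉ s := fun h => lt_irrefl a (ha a h)
    have hmin : {i ∈ insert a s | a ≤ i} = insert a s :=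
      filter_true_of_mem (by simpa using fun i hi => (ha i hi).le)
    have hrest : ∑ x ∈ s, f #{i ∈ insert a s | x ≤ i} = ∑ x ∈ s, f #{i ∈ s | x ≤ i} :=
      sum_congr rfl fun x hx => by rw [filter_insert, if_neg (ha x hx).not_ge]
    rw [sum_insert has, hmin, hrest, ih, card_insert_of_notMem has, sum_range_succ, add_comm]

theorem sum_blockEnds_consPerm_succ {M : Type*} [AddCommMonoid M] (π : Equiv.Perm (Fin n))
    (f : ℕ → M) :
    ∑ a ∈ blockEnds π, f #(blockEnds (consPerm a.succ π)) =
      ∑ k ∈ range #(blockEnds π), f (k + 1) := by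
  simp only [blockEnds_consPerm_succ, card_map]
  exact sum_card_filter_le (blockEnds π) f

end BlockEnds

section Heights

variable {n : ℕ}

theorem ascDesHeight_zero (h : ℕ) (π : Equiv.Perm (Fin (n + 1))) : ascDesHeight h π 0 = h := by
  simp [ascDesHeight]

theorem ascDesHeight_add (h c : ℕ) (π : Equiv.Perm (Fin (n + 1))) (k : Fin (n + 1)) :
    ascDesHeight (h + c) π k = ascDesHeight h π k + c := by
  simp only [ascDesHeight, Nat.cast_add]
  ring

theorem ascDesHeight_le (h : ℕ) (π : Equiv.Perm (Fin (n + 1))) (k : Fin (n + 1)) :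
    ascDesHeight h π k ≤ h + n := by
  rw [ascDesHeight]
  gcongr
  refine (sum_le_card_nsmul univ _ 1 fun i _ => ?_).trans (by simp)
  split_ifs <;> norm_num

theorem ascDesHeight_consPerm_succ (h : ℕ) (a : Fin (n + 2)) (π : Equiv.Perm (Fin (n + 1)))
    (k : Fin (n + 1)) :
    ascDesHeight h (consPerm a π) k.succ =
      ascDesHeight h π k + if a ≤ (π 0).castSucc then 1 else -1 := by
  simp only [ascDesHeight, Fin.sum_univ_succ, Fin.castSucc_zero, consPerm_zero, consPerm_succ,
    ← Fin.succ_castSucc, Fin.succAbove_lt_succAbove_iff, Fin.lt_succAbove_iff_le_castSucc,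
    Fin.val_succ, Fin.val_zero, Nat.succ_lt_succ_iff, Nat.succ_pos, if_true]
  ring

theorem isHBBallotPerm_consPerm_of_le {a : Fin (n + 2)} {π : Equiv.Perm (Fin (n + 1))}
    (ha : a ≤ (π 0).castSucc) (h b : ℕ) :
    IsHBBallotPerm h b (consPerm a π) ↔ IsHBBallotPerm (h + 1) b π := by
  simp only [IsHBBallotPerm, Fin.forall_fin_succ (n := n + 1), ← Fin.succ_last,
    ascDesHeight_consPerm_succ, ascDesHeight_zero, ascDesHeight_add, if_pos ha, Nat.cast_nonneg,
    true_and, Nat.cast_one]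

theorem isHBBallotPerm_consPerm_of_lt {a : Fin (n + 2)} {π : Equiv.Perm (Fin (n + 1))}
    (ha : (π 0).castSucc < a) (h b : ℕ) :
    IsHBBallotPerm h b (consPerm a π) ↔ h ≠ 0 ∧ IsHBBallotPerm (h - 1) b π := by
  simp only [IsHBBallotPerm, Fin.forall_fin_succ (n := n + 1), ← Fin.succ_last,
    ascDesHeight_consPerm_succ, ascDesHeight_zero, if_neg ha.not_ge, Nat.cast_nonneg, true_and]
  cases h with
  | zero =>
    have : ¬ ∀ k, 0 ≤ ascDesHeight 0 π k + -1 := fun hk => by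
      simpa [ascDesHeight_zero] using hk 0
    simp only [this, ne_eq, not_true_eq_false, false_and]
  | succ h => simp [ascDesHeight_add]

theorem consPerm_zero_mem_hbBallotPerms231 (h b : ℕ) (π : Equiv.Perm (Fin (n + 1))) :
    consPerm 0 π ∈ hbBallotPerms231 (n + 1) h b ↔ π ∈ hbBallotPerms231 n (h + 1) b := by
  simp [hbBallotPerms231, isHBBallotPerm_consPerm_of_le, avoidsPattern231_consPerm, isCut_zero]

theorem consPerm_succ_mem_hbBallotPerms231 (h b : ℕ) (a : Fin (n + 1))
    (π : Equiv.Perm (Fin (n + 1))) :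
    consPerm a.succ π ∈ hbBallotPerms231 (n + 1) h b ↔
      a ∈ blockEnds π ∧ h ≠ 0 ∧ π ∈ hbBallotPerms231 n (h - 1) b := by
  simp only [hbBallotPerms231, Set.mem_ofPred_eq, avoidsPattern231_consPerm, Fin.val_succ,
    mem_blockEnds]
  by_cases ha : IsCut π (a + 1)
  · have : (π 0).castSucc < a.succ := by simpa [Fin.lt_def] using ha 0 (by simp)
    simp only [isHBBallotPerm_consPerm_of_lt this, ha, and_true, true_and, and_assoc]
  · simp only [ha, and_false, false_and]

open Classical in
theorem sum_hbBallotPerms231_succ {M : Type*} [AddCommMonoid M] (n h b : ℕ) (f : ℕ → M) :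
    ∑ π with π ∈ hbBallotPerms231 (n + 1) h b, f #(blockEnds π) =
      (∑ π with π ∈ hbBallotPerms231 n (h + 1) b, f (#(blockEnds π) + 1)) +
      if h = 0 then 0 else
        ∑ π with π ∈ hbBallotPerms231 n (h - 1) b, ∑ k ∈ range #(blockEnds π), f (k + 1) := by
  have descent (π : Equiv.Perm (Fin (n + 1))) :
      (∑ a : Fin (n + 1), if consPerm a.succ π ∈ hbBallotPerms231 (n + 1) h b
          then f #(blockEnds (consPerm a.succ π)) else 0) =
        if h ≠ 0 ∧ π ∈ hbBallotPerms231 n (h - 1) b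
          then ∑ k ∈ range #(blockEnds π), f (k + 1) else 0 := by
    simp only [consPerm_succ_mem_hbBallotPerms231, ← sum_blockEnds_consPerm_succ π f]
    split_ifs with hπ <;> simp [hπ]
  rw [sum_filter, sum_perm_fin_succ]
  simp only [Fin.sum_univ_succ (n := n + 1), consPerm_zero_mem_hbBallotPerms231,
    blockEnds_consPerm_zero, card_cons, card_map, descent, sum_add_distrib, sum_filter]
  congr 1
  split_ifs with hh <;> simp [hh]

end Heights

section MarkedBlocks

theorem sum_range_choose_upper (k y : ℕ) : ∑ i ∈ range k, i.choose y = k.choose (y + 1) := by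
  induction k with
  | zero => simp
  | succ k ih => rw [sum_range_succ, ih, Nat.choose_succ_succ, add_comm]

theorem choose_eq_pred_add_ite {k : ℕ} (hk : 0 < k) (y : ℕ) :
    k.choose y = (k - 1).choose y + if y = 0 then 0 else (k - 1).choose (y - 1) := by
  cases y with
  | zero => simp
  | succ y => simp [Nat.choose_eq_choose_pred_add hk y.succ_pos, add_comm]

open Classical in
/-- The number of `231`-avoiding `(h, b)`-ballot permutations with `y` marked gaps between
consecutive direct-sum blocks. -/
noncomputable def numMarkedHBBallotPerms231 (n h b y : ℕ) : ℕ :=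
  ∑ π with π ∈ hbBallotPerms231 n h b, (#(blockEnds π) - 1).choose y

theorem numMarkedHBBallotPerms231_zero_right (n h b : ℕ) :
    numMarkedHBBallotPerms231 n h b 0 = (hbBallotPerms231 n h b).ncard := by
  classical
  simp only [numMarkedHBBallotPerms231, Nat.choose_zero_right, sum_const, smul_eq_mul, mul_one]
  rw [← Set.ncard_coe_finset, coe_filter_univ, Set.ofPred_mem_eq]

theorem numMarkedHBBallotPerms231_zero (h b y : ℕ) :
    numMarkedHBBallotPerms231 0 h b y = if h = b ∧ y = 0 then 1 else 0 := by
  classical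
  have hcard (π : Equiv.Perm (Fin 1)) : #(blockEnds π) = 1 :=
    le_antisymm (by simpa using card_le_univ (blockEnds π))
      (card_pos.2 ⟨_, last_mem_blockEnds π⟩)
  have hmem (π : Equiv.Perm (Fin 1)) : π ∈ hbBallotPerms231 0 h b ↔ h = b := by
    have : AvoidsPattern π pattern231 :=
      (avoidsPattern231_iff π).2 fun i j k _ _ _ => (Subsingleton.elim _ _).le
    simp [hbBallotPerms231, IsHBBallotPerm, ascDesHeight, this]
  simp only [numMarkedHBBallotPerms231, hcard, hmem, sum_filter]
  cases y <;> simp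

open Classical in
theorem sum_choose_card_blockEnds (n h b y : ℕ) :
    ∑ π with π ∈ hbBallotPerms231 n h b, (#(blockEnds π)).choose y =
      numMarkedHBBallotPerms231 n h b y +
        if y = 0 then 0 else numMarkedHBBallotPerms231 n h b (y - 1) := by
  simp only [numMarkedHBBallotPerms231, choose_eq_pred_add_ite
    (card_pos.2 ⟨_, last_mem_blockEnds _⟩) y, sum_add_distrib]
  split_ifs <;> simp

theorem numMarkedHBBallotPerms231_succ (n h b y : ℕ) :
    numMarkedHBBallotPerms231 (n + 1) h b y =
      (numMarkedHBBallotPerms231 n (h + 1) b y +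
        if y = 0 then 0 else numMarkedHBBallotPerms231 n (h + 1) b (y - 1)) +
      if h = 0 then 0 else
        numMarkedHBBallotPerms231 n (h - 1) b y +
          numMarkedHBBallotPerms231 n (h - 1) b (y + 1) := by
  rw [numMarkedHBBallotPerms231, sum_hbBallotPerms231_succ n h b fun k => (k - 1).choose y]
  simp only [Nat.add_sub_cancel, sum_range_choose_upper, sum_choose_card_blockEnds]
  simp [add_comm]

theorem numMarkedHBBallotPerms231_eq_numGBWalks (n h b y : ℕ) :
    numMarkedHBBallotPerms231 n h b y = numGBWalks n ((h + y : ℕ), y) (b, 0) := by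
  induction n generalizing h y with
  | zero =>
    rw [numMarkedHBBallotPerms231_zero, numGBWalks_zero]
    congr 1
    simp only [Prod.mk.injEq, eq_iff_iff]
    omega
  | succ n ih => simp only [numMarkedHBBallotPerms231_succ, numGBWalks_succ_nat, ih]

theorem ncard_hbBallotPerms231 (n h b : ℕ) :
    (hbBallotPerms231 n h b).ncard = numGBWalks n (h, 0) (b, 0) := by
  rw [← numMarkedHBBallotPerms231_zero_right, numMarkedHBBallotPerms231_eq_numGBWalks]
  simp

end MarkedBlocks

section PathCounts

/-- The number of `n`-step paths on `ℤ` from `0` to `k` with steps `±1`. -/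
def numFreePaths : ℕ → ℤ → ℤ
  | 0, k => if k = 0 then 1 else 0
  | n + 1, k => numFreePaths n (k + 1) + numFreePaths n (k - 1)

theorem numFreePaths_neg (n : ℕ) (k : ℤ) : numFreePaths n (-k) = numFreePaths n k := by
  induction n generalizing k with
  | zero => simp [numFreePaths]
  | succ n ih =>
    rw [numFreePaths, numFreePaths, ← ih (k + 1), ← ih (k - 1), add_comm]
    ring_nf

theorem numFreePaths_of_lt {n : ℕ} {k : ℤ} (h : n < k) : numFreePaths n k = 0 := by
  induction n generalizing k with
  | zero => rw [numFreePaths, if_neg (by omega)]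
  | succ n ih => rw [numFreePaths, ih (by omega), ih (by omega), add_zero]

theorem numFreePaths_of_odd {n : ℕ} {k : ℤ} (h : Odd (n + k)) : numFreePaths n k = 0 := by
  induction n generalizing k with
  | zero => rw [numFreePaths, if_neg (by grind)]
  | succ n ih => rw [numFreePaths, ih (by grind), ih (by grind), add_zero]

theorem numFreePaths_eq_choose (n a : ℕ) : numFreePaths n (2 * a - n) = n.choose a := by
  induction n generalizing a with
  | zero =>
    cases a with
    | zero => simp [numFreePaths]
    | succ a => rw [numFreePaths, if_neg (by omega), Nat.choose_zero_succ, Nat.cast_zero]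
  | succ n ih =>
    have up : (2 * a - (n + 1 : ℕ) + 1 : ℤ) = 2 * a - n := by push_cast; ring
    rw [numFreePaths, up, ih]
    cases a with
    | zero =>
      rw [← numFreePaths_neg, numFreePaths_of_lt (by omega)]
      simp
    | succ a =>
      have down : (2 * (a + 1 : ℕ) - (n + 1 : ℕ) - 1 : ℤ) = 2 * a - n := by push_cast; ring
      rw [down, ih, Nat.choose_succ_succ, Nat.cast_add, add_comm]

/-- The reflection-principle expression for the number of `n`-step paths from `i` to `j` with steps
`±1` that stay nonnegative. It is meaningful as a count for `i, j ≥ 0`; for other arguments it is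
the extension that is odd under reflection in `-1`. -/
def numNonnegPaths (n : ℕ) (i j : ℤ) : ℤ := numFreePaths n (i - j) - numFreePaths n (i + j + 2)

theorem numNonnegPaths_succ_left (n : ℕ) (i j : ℤ) :
    numNonnegPaths (n + 1) i j = numNonnegPaths n (i + 1) j + numNonnegPaths n (i - 1) j := by
  simp only [numNonnegPaths, numFreePaths]
  ring_nf

theorem numNonnegPaths_comm (n : ℕ) (i j : ℤ) : numNonnegPaths n i j = numNonnegPaths n j i := by
  rw [numNonnegPaths, numNonnegPaths, ← numFreePaths_neg, neg_sub, add_comm i j]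

theorem numNonnegPaths_succ_right (n : ℕ) (i j : ℤ) :
    numNonnegPaths (n + 1) i j = numNonnegPaths n i (j + 1) + numNonnegPaths n i (j - 1) := by
  simp only [numNonnegPaths_comm n i, numNonnegPaths_comm (n + 1) i, numNonnegPaths_succ_left]

theorem numNonnegPaths_reflect_right (n : ℕ) (i j : ℤ) :
    numNonnegPaths n i (-2 - j) = -numNonnegPaths n i j := by
  simp only [numNonnegPaths]
  ring_nf

theorem numNonnegPaths_neg_one_right (n : ℕ) (i : ℤ) : numNonnegPaths n i (-1) = 0 := by
  simpa [self_eq_neg] using numNonnegPaths_reflect_right n i (-1)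

theorem numNonnegPaths_neg_one_left (n : ℕ) (j : ℤ) : numNonnegPaths n (-1) j = 0 := by
  rw [numNonnegPaths_comm, numNonnegPaths_neg_one_right]

theorem numNonnegPaths_zero_of_lt {n : ℕ} {j : ℤ} (h : n < j) : numNonnegPaths n 0 j = 0 := by
  rw [numNonnegPaths, ← numFreePaths_neg, numFreePaths_of_lt (by omega),
    numFreePaths_of_lt (by omega), sub_zero]

theorem numNonnegPaths_of_odd {n : ℕ} {i j : ℤ} (h : Odd (n + i + j)) :
    numNonnegPaths n i j = 0 := by
  rw [numNonnegPaths, numFreePaths_of_odd (by grind), numFreePaths_of_odd (by grind), sub_zero]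

theorem numNonnegPaths_eq_catalan (m : ℕ) : numNonnegPaths (2 * m) 0 0 = catalan m := by
  have center : numFreePaths (2 * m) (0 - 0) = (2 * m).choose m := by
    rw [← numFreePaths_eq_choose]
    push_cast
    ring_nf
  have reflected : numFreePaths (2 * m) (0 + 0 + 2) = (2 * m).choose (m + 1) := by
    rw [← numFreePaths_eq_choose]
    push_cast
    ring_nf
  have absorb : ((2 * m).choose (m + 1) * (m + 1) : ℤ) = (2 * m).choose m * m := by
    have := Nat.choose_succ_right_eq (2 * m) m
    rw [two_mul, Nat.add_sub_cancel, ← two_mul] at this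
    exact_mod_cast this
  have central : ((m + 1) * catalan m : ℤ) = (2 * m).choose m := by
    exact_mod_cast succ_mul_catalan_eq_centralBinom m
  rw [numNonnegPaths, center, reflected]
  refine mul_left_cancel₀ (by positivity : (m + 1 : ℤ) ≠ 0) ?_
  linear_combination -absorb - central

theorem numNonnegPaths_two_left (n : ℕ) (j : ℤ) :
    numNonnegPaths n 2 j =
      numNonnegPaths n 0 (j + 2) + numNonnegPaths n 0 j + numNonnegPaths n 0 (j - 2) := by
  have fromLeft : numNonnegPaths (n + 2) 0 j = numNonnegPaths n 2 j + numNonnegPaths n 0 j := by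
    rw [numNonnegPaths_succ_left, zero_sub, numNonnegPaths_neg_one_left, numNonnegPaths_succ_left]
    norm_num
  have fromRight : numNonnegPaths (n + 2) 0 j =
      numNonnegPaths n 0 (j + 2) + 2 * numNonnegPaths n 0 j + numNonnegPaths n 0 (j - 2) := by
    rw [numNonnegPaths_succ_right, numNonnegPaths_succ_right, numNonnegPaths_succ_right]
    ring_nf
  linarith

theorem numNonnegPaths_succ_zero_zero (n : ℕ) :
    numNonnegPaths (n + 1) 0 0 = numNonnegPaths n 0 1 := by
  rw [numNonnegPaths_succ_right, zero_sub, numNonnegPaths_neg_one_right, zero_add, add_zero]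

end PathCounts

section Determinant

/-- The Lindström-Gessel-Viennot determinant for the pairs of nonintersecting nonnegative paths
traced by `x - y` and `x + y + 2` along an `n`-step walk from `p` to `q`. The shift by `2` turns
weakly ordered paths into strictly ordered ones and preserves their common parity. -/
def pathDet (n : ℕ) (p q : ℤ × ℤ) : ℤ :=
  numNonnegPaths n (p.1 - p.2) (q.1 - q.2) * numNonnegPaths n (p.1 + p.2 + 2) (q.1 + q.2 + 2) -
    numNonnegPaths n (p.1 - p.2) (q.1 + q.2 + 2) * numNonnegPaths n (p.1 + p.2 + 2) (q.1 - q.2)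

theorem pathDet_zero {p q : ℤ × ℤ} (hp : p ∈ gbWedge) (hq : q ∈ gbWedge) :
    pathDet 0 p q = if p = q then 1 else 0 := by
  obtain ⟨x, y⟩ := p
  obtain ⟨x', y'⟩ := q
  rw [mem_gbWedge] at hp hq
  simp only [pathDet, numNonnegPaths, numFreePaths, Prod.mk.injEq]
  split_ifs <;> omega

theorem pathDet_succ (n : ℕ) (p q : ℤ × ℤ) :
    pathDet (n + 1) p q = ∑ s ∈ gbStepFinset, pathDet n (s + p) q := by
  obtain ⟨x, y⟩ := p
  simp only [sum_gbStepFinset, Prod.mk_add_mk, pathDet, numNonnegPaths_succ_left]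
  ring_nf

theorem pathDet_of_exit {p s : ℤ × ℤ} (hp : p ∈ gbWedge) (hs : s ∈ gbStepFinset)
    (hsp : s + p ∉ gbWedge) (n : ℕ) (q : ℤ × ℤ) : pathDet n (s + p) q = 0 := by
  have hexit : (s + p).2 = -1 ∨ (s + p).1 - (s + p).2 = -1 := by
    simp only [gbStepFinset, mem_insert, mem_singleton] at hs
    rcases hs with rfl | rfl | rfl | rfl <;>
      simp only [gbWedge, Set.mem_ofPred_eq, Prod.fst_add, Prod.snd_add] at hp hsp ⊢ <;> omega
  rw [pathDet]
  rcases hexit with hy | hxy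
  · rw [hy, show (s + p).1 + -1 + 2 = (s + p).1 - -1 by ring]
    ring
  · rw [hxy]
    simp only [numNonnegPaths_neg_one_left, zero_mul, sub_zero]

theorem numGBWalks_eq_pathDet {p q : ℤ × ℤ} (hp : p ∈ gbWedge) (hq : q ∈ gbWedge) (n : ℕ) :
    (numGBWalks n p q : ℤ) = pathDet n p q :=
  cast_numLatticeWalks_eq_of_recurrence (f := fun n p => pathDet n p q)
    (fun _ hp => pathDet_zero hp hq) (fun n p _ => pathDet_succ n p q)
    (fun n _ hp _ hs hsp => pathDet_of_exit hp hs hsp n q) n hp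

theorem numGBWalks_origin_eq_sub (n b : ℕ) :
    (numGBWalks n (0, 0) (b, 0) : ℤ) =
      (numNonnegPaths n 0 b ^ 2 - numNonnegPaths n 0 (b - 2) * numNonnegPaths n 0 (b + 2)) -
        (numNonnegPaths n 0 (b + 2) ^ 2 - numNonnegPaths n 0 b * numNonnegPaths n 0 (b + 4)) := by
  rw [numGBWalks_eq_pathDet (mem_gbWedge.2 (by simp)) (mem_gbWedge.2 (by simp))]
  simp only [pathDet, sub_zero, zero_add, add_zero, numNonnegPaths_two_left]
  ring_nf

theorem sum_numGBWalks_origin (n : ℕ) :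
    (∑ b ∈ range (n + 1), numGBWalks n (0, 0) (b, 0) : ℤ) =
      numNonnegPaths n 0 0 * numNonnegPaths (n + 2) 0 0 + numNonnegPaths (n + 1) 0 0 ^ 2 := by
  set β : ℤ → ℤ := numNonnegPaths n 0 with hβ
  set g : ℕ → ℤ := fun b => β b ^ 2 - β (b - 2) * β (b + 2) with hg
  have hdiff (b : ℕ) :
      (numGBWalks n (0, 0) (b, 0) : ℤ) = (g b + g (b + 1)) - (g (b + 1) + g (b + 2)) := by
    rw [numGBWalks_origin_eq_sub]
    simp only [hg, hβ]
    push_cast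
    ring_nf
  have hfar (b : ℕ) (hb : n < b) : g b = 0 := by
    have hvanish (j : ℤ) (hj : n < j) : β j = 0 := numNonnegPaths_zero_of_lt hj
    simp [hg, hvanish b (by omega), hvanish (b + 2) (by omega)]
  have hneg_one : β (-1) = 0 := numNonnegPaths_neg_one_right n 0
  have hneg_two : β (-2) = -β 0 := numNonnegPaths_reflect_right n 0 0
  have htwo : numNonnegPaths (n + 2) 0 0 = β 2 + β 0 := by
    rw [numNonnegPaths_succ_zero_zero, numNonnegPaths_succ_right]
    norm_num [hβ]
  calc (∑ b ∈ range (n + 1), numGBWalks n (0, 0) (b, 0) : ℤ)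
      = (g 0 + g 1) - (g (n + 1) + g (n + 2)) := by
        simp only [hdiff]
        exact sum_range_sub' (fun b => g b + g (b + 1)) (n + 1)
    _ = g 0 + g 1 := by rw [hfar (n + 1) (by omega), hfar (n + 2) (by omega)]; ring
    _ = _ := by
        rw [htwo, numNonnegPaths_succ_zero_zero, ← hβ]
        simp only [hg, Nat.cast_zero, Nat.cast_one, zero_sub, zero_add, Int.reduceSub,
          Int.reduceAdd, hneg_one, hneg_two]
        ring

theorem sum_numGBWalks_origin_eq_catalan_mul (n : ℕ) :
    ∑ b ∈ range (n + 1), numGBWalks n (0, 0) (b, 0) =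
      catalan ((n + 1) / 2) * catalan ((n + 2) / 2) := by
  zify
  rw [sum_numGBWalks_origin]
  have odd_vanish {k : ℕ} (hk : Odd k) : numNonnegPaths k 0 0 = 0 :=
    numNonnegPaths_of_odd (by simpa using hk)
  obtain ⟨m, rfl | rfl⟩ := Nat.even_or_odd' n
  · have half₁ : (2 * m + 1) / 2 = m := by omega
    have half₂ : (2 * m + 2) / 2 = m + 1 := by omega
    rw [odd_vanish ⟨m, rfl⟩, half₁, half₂, ← numNonnegPaths_eq_catalan, ← numNonnegPaths_eq_catalan,
      mul_add_one]
    ring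
  · have half₁ : (2 * m + 1 + 1) / 2 = m + 1 := by omega
    have half₂ : (2 * m + 1 + 2) / 2 = m + 1 := by omega
    rw [odd_vanish ⟨m, rfl⟩, half₁, half₂, ← numNonnegPaths_eq_catalan, mul_add_one]
    ring

end Determinant

section BallotPerms

variable {n : ℕ}

theorem ascDesHeight_zero_left (π : Equiv.Perm (Fin (n + 1))) (k : Fin (n + 1)) :
    ascDesHeight 0 π k = prefixAsc π (k + 1) - prefixDes π (k + 1) := by
  simp only [ascDesHeight, prefixAsc, prefixDes, card_filter]
  rw [Fin.sum_univ_castSucc, Fin.sum_univ_castSucc]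
  push_cast
  rw [if_neg (by simp), if_neg (by simp), add_zero, add_zero, zero_add, ← sum_sub_distrib]
  refine sum_congr rfl fun i _ => ?_
  have hsucc (h : i.val + 1 < n + 1) : (⟨i.val + 1, h⟩ : Fin (n + 1)) = i.succ := rfl
  rcases lt_or_gt_of_ne (π.injective.ne i.castSucc_lt_succ.ne) with h | h <;>
    simp [hsucc, h, h.not_gt, apply_ite Neg.neg]

theorem isBallotPerm_iff_ascDesHeight_nonneg (π : Equiv.Perm (Fin (n + 1))) :
    IsBallotPerm π ↔ ∀ k : Fin (n + 1), 0 ≤ ascDesHeight 0 π k := by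
  simp only [ascDesHeight_zero_left, sub_nonneg, Nat.cast_le]
  constructor
  · exact fun h k => h _ k.isLt
  · rintro h (_ | k) hk
    · simp [prefixDes]
    · exact h ⟨k, hk⟩

theorem ballotPerms231_succ (n : ℕ) :
    ballotPerms231 (n + 1) = ⋃ b ∈ (range (n + 1) : Set ℕ), hbBallotPerms231 n 0 b := by
  ext π
  simp only [ballotPerms231, hbBallotPerms231, Set.mem_ofPred_eq, Set.mem_iUnion,
    isBallotPerm_iff_ascDesHeight_nonneg, IsHBBallotPerm, mem_coe, mem_range, exists_prop]
  constructor
  · rintro ⟨hnonneg, hav⟩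
    obtain ⟨b, hb⟩ := Int.eq_ofNat_of_zero_le (hnonneg (Fin.last n))
    have hle := ascDesHeight_le 0 π (Fin.last n)
    exact ⟨b, by omega, ⟨hnonneg, hb⟩, hav⟩
  · rintro ⟨b, -, ⟨hnonneg, -⟩, hav⟩
    exact ⟨hnonneg, hav⟩

theorem pairwiseDisjoint_hbBallotPerms231 (n h : ℕ) (s : Set ℕ) :
    s.PairwiseDisjoint (hbBallotPerms231 n h) := by
  intro b _ c _ hbc
  refine Set.disjoint_left.2 ?_
  rintro π ⟨⟨-, hb⟩, -⟩ ⟨⟨-, hc⟩, -⟩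
  exact hbc (by exact_mod_cast hb.symm.trans hc)

theorem ncard_ballotPerms231_succ (n : ℕ) :
    (ballotPerms231 (n + 1)).ncard = ∑ b ∈ range (n + 1), (hbBallotPerms231 n 0 b).ncard := by
  rw [ballotPerms231_succ, (finite_toSet _).ncard_biUnion (fun _ _ => Set.toFinite _)
    (pairwiseDisjoint_hbBallotPerms231 n 0 _), finsum_mem_coe_finset]

theorem ballotPerms231_zero : ballotPerms231 0 = Set.univ :=
  Set.eq_univ_of_forall fun π =>
    ⟨fun k _ => by simp [prefixDes], (avoidsPattern231_iff π).2 fun i => i.elim0⟩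

end BallotPerms

theorem theorem4p5 :
    (∀ n h b : ℕ, (hbBallotPerms231 n h b).encard = (gbWalks n h b).encard) ∧
      ∀ n : ℕ, (ballotPerms231 n).ncard = catalan (n / 2) * catalan ((n + 1) / 2) := by
  refine ⟨fun n h b => ?_, fun n => ?_⟩
  · rw [encard_gbWalks, ← ncard_hbBallotPerms231, (Set.toFinite _).cast_ncard_eq]
  · cases n with
    | zero => simp [ballotPerms231_zero, Set.ncard_univ]
    | succ n =>
      rw [ncard_ballotPerms231_succ, ← sum_numGBWalks_origin_eq_catalan_mul]
      simp only [ncard_hbBallotPerms231, Nat.cast_zero]
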